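/- Let $T$ be a full binary tree with $n$ leaves, labelled bijectively by $[n]=\{1,\dots,n\}$, and let $\tilde p_1,\dots,\tilde p_n\in[0,1]$ satisfy $\sum_{i=1}^n\tilde p_i=k$ for an integer $k\ge 0$. Binary-tree-based pivotal sampling draws a random set $\mathcal A\subseteq[n]$ as follows. Start with $\mathcal A=\emptyset$, each leaf storing its label. While the tree has more than one node, select any pair of sibling leaves (the choice may depend on the previous outcomes), storing indices $i$ and $j$, say, and let them compete: \begin{itemize} \item If $\tilde p_i+\tilde p_j\le 1$: with probability $\frac{\tilde p_i}{\tilde p_i+\tilde p_j}$ set $\tilde p_i\gets\tilde p_i+\tilde p_j$, $\tilde p_j\gets 0$ and store $i$ at the parent; otherwise set $\tilde p_j\gets\tilde p_i+\tilde p_j$, $\tilde p_i\gets 0$ and store $j$ at the parent. \item If $\tilde p_i+\tilde p_j>1$: with probability $\frac{1-\tilde p_i}{2-\tilde p_i-\tilde p_j}$ set $\tilde p_i\gets\tilde p_i+\tilde p_j-1$, $\tilde p_j\gets 1$, store $i$ at the parent and add $j$ to $\mathcal A$; otherwise set $\tilde p_j\gets\tilde p_i+\tilde p_j-1$, $\tilde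 p_i\gets 1$, store $j$ at the parent and add $i$ to $\mathcal A$. \end{itemize} (A quotient $0/0$ is read as $0$.) Then remove the two leaves, so that the parent becomes a leaf. When only the root is left, add the index stored there to $\mathcal A$ if its current probability is $1$. Let $\xi_i\in\{0,1\}$ be the indicator of $i\in\mathcal A$. Let $\mathcal S\subseteq[n]$ be such that $\Pr[\xi_l=1\ \forall l\in\mathcal S]>0$. Then, conditioned on $\xi_l=1$ for all $l\in\mathcal S$, the remaining indicators are pairwise negatively correlated: for any two distinct $i,j\in[n]\setminus\mathcal S$, $$\Pr[\xi_i=1\mid \xi_l=1\ \forall l\in\mathcal S]\cdot\Pr[\xi_j=1\mid \xi_l=1\ \forall l\in\mathcal S]\ \ge\ \Pr[\xi_i=1,\ \xi_j=1\mid \xi_l=1\ \forall l\in\mathcal S].$$ -/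

import Mathlib

open MeasureTheory ProbabilityTheory

namespace PivotalSampling

/-- Full binary trees (every node has no child or two children) storing an index at each leaf. -/
inductive IndexTree (ι : Type) : Type
  | leaf (i : ι) : IndexTree ι
  | node (l r : IndexTree ι) : IndexTree ι

/-- The indices stored at the leaves, from left to right. -/
def IndexTree.leaves {ι : Type} : IndexTree ι → List ι
  | .leaf i => [i]
  | .node l r => l.leaves ++ r.leaves

/-- `SiblingPair T i j C`: the tree `T` has two sibling leaves (in either order) storing `i` and
`j`, and `C x` is the tree that results from `T` when these two leaves are removed and `x` is
stored at their parent. -/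
inductive SiblingPair {ι : Type} : IndexTree ι → ι → ι → (ι → IndexTree ι) → Prop
  | here (i j : ι) : SiblingPair (.node (.leaf i) (.leaf j)) i j .leaf
  | swapped (i j : ι) : SiblingPair (.node (.leaf j) (.leaf i)) i j .leaf
  | left {l r : IndexTree ι} {i j : ι} {C : ι → IndexTree ι} (h : SiblingPair l i j C) :
      SiblingPair (.node l r) i j (fun x => .node (C x) r)
  | right {l r : IndexTree ι} {i j : ι} {C : ι → IndexTree ι} (h : SiblingPair r i j C) :
      SiblingPair (.node l r) i j (fun x => .node l (C x))

/-- The mixture `q μ + (1 - q) ν`: with probability `q` proceed as in `μ`,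
otherwise as in `ν`. -/
noncomputable def mix {Ω : Type} [MeasurableSpace Ω] (q : ℝ) (μ ν : Measure Ω) : Measure Ω :=
  ENNReal.ofReal q • μ + ENNReal.ofReal (1 - q) • ν

/-- `RunLaw T p A μ`: if the pivotal method is in the state with remaining tree `T`, current
inclusion probabilities `p` and set `A` of indices selected so far, then some way of choosing the
sibling pairs (which may depend on all earlier random outcomes) makes `μ` the law of the
indicator vector `ξ` of the final sample.

* `done`: one node is left; its index is in the sample if its probability has become `1`.
* `low`, `high`: a match between sibling leaves storing `i` and `j`, when `p i + p j ≤ 1` and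
  when `p i + p j > 1`, respectively.

The quotients are `0 / 0` only if `p i = p j = 0` or `p i = p j = 1`; the two outcomes of the match
then differ only in which of two equal competitors moves up. -/
inductive RunLaw {ι : Type} [DecidableEq ι] :
    IndexTree ι → (ι → ℝ) → Finset ι → Measure (ι → Bool) → Prop
  | done (r : ι) (p : ι → ℝ) (A : Finset ι) :
      RunLaw (.leaf r) p A
        (Measure.dirac (fun i => decide (i ∈ if p r = 1 then insert r A else A)))
  | low {T : IndexTree ι} {i j : ι} {C : ι → IndexTree ι} {p : ι → ℝ} {A : Finset ι}
      {μ ν : Measure (ι → Bool)} (hT : SiblingPair T i j C) (hp : p i + p j ≤ 1)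
      (hi : RunLaw (C i) (Function.update (Function.update p i (p i + p j)) j 0) A μ)
      (hj : RunLaw (C j) (Function.update (Function.update p j (p i + p j)) i 0) A ν) :
      RunLaw T p A (mix (p i / (p i + p j)) μ ν)
  | high {T : IndexTree ι} {i j : ι} {C : ι → IndexTree ι} {p : ι → ℝ} {A : Finset ι}
      {μ ν : Measure (ι → Bool)} (hT : SiblingPair T i j C) (hp : 1 < p i + p j)
      (hi : RunLaw (C i) (Function.update (Function.update p i (p i + p j - 1)) j 1)
        (insert j A) μ)
      (hj : RunLaw (C j) (Function.update (Function.update p j (p i + p j - 1)) i 1)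
        (insert i A) ν) :
      RunLaw T p A (mix ((1 - p i) / (2 - p i - p j)) μ ν)

/-- `μ` is the law of the indicator vector of the sample drawn by binary-tree-based pivotal
sampling on the tree `T` with inclusion probabilities `p`. -/
def IsPivotalLaw {ι : Type} [DecidableEq ι] (T : IndexTree ι) (p : ι → ℝ)
    (μ : Measure (ι → Bool)) : Prop :=
  RunLaw T p ∅ μ

end PivotalSampling

namespace PivotalSampling

section Combine

/-- The residual mass that moves up after a match of competitors of masses `x` and `y`. -/
noncomputable def residual (x y : ℝ) : ℝ := if x + y ≤ 1 then x + y else x + y - 1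

/-- The weights of a match between competitors of masses `x` and `y`. The first (second) component
of `u` and `v` is the weight given that the competitor is finally selected (not selected), and
likewise for the result. If the residual mass is `1`, its holder is always selected, and both
components agree. -/
noncomputable def combine (x y : ℝ) (u v : ℝ × ℝ) : ℝ × ℝ :=
  if x + y ≤ 1 then
    (x / (x + y) * (u.1 * v.2) + (1 - x / (x + y)) * (u.2 * v.1),
      if x + y = 1 then x / (x + y) * (u.1 * v.2) + (1 - x / (x + y)) * (u.2 * v.1)
      else u.2 * v.2)
  else
    (u.1 * v.1, (1 - x) / (2 - x - y) * (u.2 * v.1) + (1 - (1 - x) / (2 - x - y)) * (u.1 * v.2))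

/-- The weights of a single index of mass `x` that contributes the factor `w` if it is not
selected. -/
noncomputable def leafWeight (x w : ℝ) : ℝ × ℝ := (if x = 0 then w else 1, if x = 1 then 1 else w)

lemma residual_mem {x y : ℝ} (hx : x ∈ Set.Icc (0 : ℝ) 1) (hy : y ∈ Set.Icc (0 : ℝ) 1) :
    residual x y ∈ Set.Icc (0 : ℝ) 1 := by
  obtain ⟨hx0, hx1⟩ := hx
  obtain ⟨hy0, hy1⟩ := hy
  unfold residual
  split_ifs <;> constructor <;> linarith

lemma low_prob_mem {x y : ℝ} (hx : x ∈ Set.Icc (0 : ℝ) 1) (hy : y ∈ Set.Icc (0 : ℝ) 1) :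
    x / (x + y) ∈ Set.Icc (0 : ℝ) 1 :=
  ⟨div_nonneg hx.1 (add_nonneg hx.1 hy.1),
    div_le_one_of_le₀ (by linarith [hy.1]) (add_nonneg hx.1 hy.1)⟩

lemma high_prob_mem {x y : ℝ} (hx : x ∈ Set.Icc (0 : ℝ) 1) (hy : y ∈ Set.Icc (0 : ℝ) 1) :
    (1 - x) / (2 - x - y) ∈ Set.Icc (0 : ℝ) 1 :=
  ⟨div_nonneg (by linarith [hx.2]) (by linarith [hx.2, hy.2]),
    div_le_one_of_le₀ (by linarith [hy.2]) (by linarith [hx.2, hy.2])⟩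

lemma combine_nonneg {x y : ℝ} (hx : x ∈ Set.Icc (0 : ℝ) 1) (hy : y ∈ Set.Icc (0 : ℝ) 1)
    {u v : ℝ × ℝ} (hu : 0 ≤ u) (hv : 0 ≤ v) : 0 ≤ combine x y u v := by
  obtain ⟨hu1, hu2⟩ := Prod.le_def.1 hu
  obtain ⟨hv1, hv2⟩ := Prod.le_def.1 hv
  obtain ⟨a0, a1⟩ := low_prob_mem hx hy
  obtain ⟨b0, b1⟩ := high_prob_mem hx hy
  simp only [Prod.fst_zero, Prod.snd_zero] at hu1 hu2 hv1 hv2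
  rw [← sub_nonneg] at a1 b1
  unfold combine
  split_ifs <;> refine Prod.le_def.2 ⟨?_, ?_⟩ <;>
    simp only [Prod.fst_zero, Prod.snd_zero] <;> positivity

lemma combine_add_left (x y c d : ℝ) (u u' v : ℝ × ℝ) :
    combine x y (c • u + d • u') v = c • combine x y u v + d • combine x y u' v := by
  unfold combine
  split_ifs <;> ext <;> simp <;> ring

lemma combine_add_right (x y c d : ℝ) (u v v' : ℝ × ℝ) :
    combine x y u (c • v + d • v') = c • combine x y u v + d • combine x y u v' := by
  unfold combine
  split_ifs <;> ext <;> simp <;> ring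

/-- A nonnegative combination of the two components of `combine` is a bilinear form with
nonnegative coefficients and nonpositive determinant. -/
lemma exists_combine_form {x y : ℝ} (hx : x ∈ Set.Icc (0 : ℝ) 1) (hy : y ∈ Set.Icc (0 : ℝ) 1)
    {a b : ℝ} (ha : 0 ≤ a) (hb : 0 ≤ b) :
    ∃ c₁₁ c₁₂ c₂₁ c₂₂ : ℝ, 0 ≤ c₁₁ ∧ 0 ≤ c₁₂ ∧ 0 ≤ c₂₁ ∧ 0 ≤ c₂₂ ∧ c₁₁ * c₂₂ ≤ c₁₂ * c₂₁ ∧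
      ∀ u v : ℝ × ℝ, a * (combine x y u v).1 + b * (combine x y u v).2 =
        c₁₁ * (u.1 * v.1) + c₁₂ * (u.1 * v.2) + c₂₁ * (u.2 * v.1) + c₂₂ * (u.2 * v.2) := by
  obtain ⟨a0, a1⟩ := low_prob_mem hx hy
  obtain ⟨b0, b1⟩ := high_prob_mem hx hy
  rw [← sub_nonneg] at a1 b1
  unfold combine
  split_ifs
  · refine ⟨0, (a + b) * (x / (x + y)), (a + b) * (1 - x / (x + y)), 0, le_rfl, by positivity,
      by positivity, le_rfl, ?_, fun u v => by ring⟩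
    rw [zero_mul]; positivity
  · refine ⟨0, a * (x / (x + y)), a * (1 - x / (x + y)), b, le_rfl, by positivity,
      by positivity, hb, ?_, fun u v => by ring⟩
    rw [zero_mul]; positivity
  · refine ⟨a, b * (1 - (1 - x) / (2 - x - y)), b * ((1 - x) / (2 - x - y)), 0, ha, by positivity,
      by positivity, le_rfl, ?_, fun u v => by ring⟩
    rw [mul_zero]; positivity

lemma combine_cross_left {x y : ℝ} (hx : x ∈ Set.Icc (0 : ℝ) 1) (hy : y ∈ Set.Icc (0 : ℝ) 1)
    {u u' : ℝ × ℝ} (v : ℝ × ℝ) (h : u'.2 * u.1 ≤ u'.1 * u.2) :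
    (combine x y u' v).2 * (combine x y u v).1 ≤ (combine x y u' v).1 * (combine x y u v).2 := by
  obtain ⟨a0, -⟩ := low_prob_mem hx hy
  obtain ⟨b0, -⟩ := high_prob_mem hx hy
  rw [← sub_nonneg] at h ⊢
  unfold combine
  split_ifs
  · exact le_of_eq (by ring)
  · have := mul_nonneg (mul_nonneg a0 (sq_nonneg v.2)) h
    exact this.trans_eq (by ring)
  · have := mul_nonneg (mul_nonneg b0 (sq_nonneg v.1)) h
    exact this.trans_eq (by ring)

lemma combine_cross_right {x y : ℝ} (hx : x ∈ Set.Icc (0 : ℝ) 1) (hy : y ∈ Set.Icc (0 : ℝ) 1)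
    (u : ℝ × ℝ) {v v' : ℝ × ℝ} (h : v'.2 * v.1 ≤ v'.1 * v.2) :
    (combine x y u v').2 * (combine x y u v).1 ≤ (combine x y u v').1 * (combine x y u v).2 := by
  obtain ⟨-, a1⟩ := low_prob_mem hx hy
  obtain ⟨-, b1⟩ := high_prob_mem hx hy
  rw [← sub_nonneg] at h a1 b1 ⊢
  unfold combine
  split_ifs
  · exact le_of_eq (by ring)
  · have := mul_nonneg (mul_nonneg a1 (sq_nonneg u.2)) h
    exact this.trans_eq (by ring)
  · have := mul_nonneg (mul_nonneg b1 (sq_nonneg u.1)) h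
    exact this.trans_eq (by ring)

lemma combine_leafWeight_low {x y : ℝ} (hx : 0 ≤ x) (hy : 0 ≤ y) (h : x + y ≤ 1) (w z : ℝ) :
    combine x y (leafWeight x w) (leafWeight y z) =
      (x / (x + y) * z) • leafWeight (x + y) w +
        ((1 - x / (x + y)) * w) • leafWeight (x + y) z := by
  rcases hx.eq_or_lt with rfl | hx
  · rcases hy.eq_or_lt with rfl | hy
    · ext <;> simp [combine, leafWeight]
    · by_cases hy1 : y = 1
      · subst hy1; ext <;> simp [combine, leafWeight]
      · have : y ≤ 1 := by linarith
        ext <;> simp [combine, leafWeight, hy.ne', hy1, this]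
  · rcases hy.eq_or_lt with rfl | hy
    · by_cases hx1 : x = 1
      · subst hx1; ext <;> simp [combine, leafWeight]
      · have : x ≤ 1 := by linarith
        ext <;> simp [combine, leafWeight, hx.ne', hx1, this, mul_comm]
    · have hx1 : x ≠ 1 := by linarith
      have hy1 : y ≠ 1 := by linarith
      have hs : x + y ≠ 0 := by positivity
      by_cases h1 : x + y = 1
      · ext <;> simp [combine, leafWeight, hx.ne', hy.ne', hx1, hy1, h1]
      · ext <;> simp [combine, leafWeight, hx.ne', hy.ne', hx1, hy1, h1, h, hs]
        ring

lemma combine_leafWeight_high {x y : ℝ} (hx : x ≤ 1) (hy : y ≤ 1) (h : 1 < x + y) (w z : ℝ) :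
    combine x y (leafWeight x w) (leafWeight y z) =
      ((1 - x) / (2 - x - y)) • leafWeight (x + y - 1) w +
        (1 - (1 - x) / (2 - x - y)) • leafWeight (x + y - 1) z := by
  have hx0 : x ≠ 0 := by linarith
  have hy0 : y ≠ 0 := by linarith
  have hs : x + y - 1 ≠ 0 := by linarith
  have hl : ¬ x + y ≤ 1 := by linarith
  rcases hx.eq_or_lt with rfl | hx
  · ext <;> simp [combine, leafWeight, hy0, hl]
  · rcases hy.eq_or_lt with rfl | hy
    · have h2 : 2 - x - 1 ≠ 0 := by linarith
      have h3 : (1 - x) / (2 - x - 1) = 1 := by rw [div_eq_one_iff_eq h2]; ring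
      ext <;> simp [combine, leafWeight, hx0, hl, h3]
    · have h1 : x + y - 1 ≠ 1 := by linarith
      ext <;> simp [combine, leafWeight, hx0, hy0, hl, hs, hx.ne, hy.ne, h1]

lemma combine_leafWeight_comm {x y : ℝ} (hx : x ∈ Set.Icc (0 : ℝ) 1) (hy : y ∈ Set.Icc (0 : ℝ) 1)
    (w z : ℝ) : combine y x (leafWeight y z) (leafWeight x w) =
      combine x y (leafWeight x w) (leafWeight y z) := by
  obtain ⟨hx0, hx1⟩ := hx
  obtain ⟨hy0, hy1⟩ := hy
  rcases le_or_gt (x + y) 1 with h | h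
  · by_cases hs : x + y = 0
    · obtain rfl : x = 0 := by linarith
      obtain rfl : y = 0 := by linarith
      ext <;> simp [combine, leafWeight, mul_comm]
    · have e : y / (x + y) = 1 - x / (x + y) := by field_simp; ring
      rw [combine_leafWeight_low hx0 hy0 h, combine_leafWeight_low hy0 hx0 (by linarith),
        add_comm y x, e, sub_sub_cancel, add_comm]
  · by_cases hs : 2 - x - y = 0
    · obtain rfl : x = 1 := by linarith
      obtain rfl : y = 1 := by linarith
      ext <;> simp [combine, leafWeight]
    · have e : (1 - y) / (2 - x - y) = 1 - (1 - x) / (2 - x - y) := by field_simp; ring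
      rw [combine_leafWeight_high hx1 hy1 h, combine_leafWeight_high hy1 hx1 (by linarith),
        add_comm y x, sub_right_comm 2 y x, e, sub_sub_cancel, add_comm]

lemma leafWeight_nonneg {w : ℝ} (x : ℝ) (hw : 0 ≤ w) : 0 ≤ leafWeight x w := by
  unfold leafWeight
  refine Prod.le_def.2 ⟨?_, ?_⟩ <;> dsimp only <;> split_ifs <;> simp [hw]

lemma leafWeight_cross {w : ℝ} (x : ℝ) (hw : 0 ≤ w) :
    (leafWeight x 0).2 * (leafWeight x w).1 ≤ (leafWeight x 0).1 * (leafWeight x w).2 := by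
  unfold leafWeight
  dsimp only
  split_ifs <;> simp_all

end Combine

namespace IndexTree

variable {ι : Type}

/-- The mass held by the index that moves up to the root. -/
noncomputable def mass (p : ι → ℝ) : IndexTree ι → ℝ
  | .leaf i => p i
  | .node l r => residual (l.mass p) (r.mass p)

/-- The expected product of `w l` over the indices `l` of the tree that are not selected, given
that the index which moves up to the root is finally selected (first component) or not
(second component). -/
noncomputable def weight (p w : ι → ℝ) : IndexTree ι → ℝ × ℝ
  | .leaf i => leafWeight (p i) (w i)
  | .node l r => combine (l.mass p) (r.mass p) (l.weight p w) (r.weight p w)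

lemma mass_congr {p q : ι → ℝ} : ∀ {T : IndexTree ι}, (∀ i ∈ T.leaves, p i = q i) →
    T.mass p = T.mass q
  | .leaf i, h => h i (by simp [leaves])
  | .node l r, h => by
    simp only [leaves, List.mem_append] at h
    rw [mass, mass, mass_congr fun i hi => h i (.inl hi), mass_congr fun i hi => h i (.inr hi)]

lemma weight_congr {p q w z : ι → ℝ} : ∀ {T : IndexTree ι}, (∀ i ∈ T.leaves, p i = q i) →
    (∀ i ∈ T.leaves, w i = z i) → T.weight p w = T.weight q z
  | .leaf i, h, h' => by
    rw [weight, weight, h i (by simp [leaves]), h' i (by simp [leaves])]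
  | .node l r, h, h' => by
    simp only [leaves, List.mem_append] at h h'
    rw [weight, weight, mass_congr fun i hi => h i (.inl hi), mass_congr fun i hi => h i (.inr hi),
      weight_congr (fun i hi => h i (.inl hi)) fun i hi => h' i (.inl hi),
      weight_congr (fun i hi => h i (.inr hi)) fun i hi => h' i (.inr hi)]

lemma weight_update_of_notMem [DecidableEq ι] (p w : ι → ℝ) {T : IndexTree ι} {i : ι}
    (hi : i ∉ T.leaves) (c : ℝ) : T.weight p (Function.update w i c) = T.weight p w :=
  weight_congr (fun _ _ => rfl) fun _ hj =>
    Function.update_of_ne (ne_of_mem_of_not_mem hj hi) _ _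

lemma mass_mem {p : ι → ℝ} (hp : ∀ i, p i ∈ Set.Icc (0 : ℝ) 1) :
    ∀ T : IndexTree ι, T.mass p ∈ Set.Icc (0 : ℝ) 1
  | .leaf i => hp i
  | .node l r => residual_mem (mass_mem hp l) (mass_mem hp r)

lemma weight_nonneg {p w : ι → ℝ} (hp : ∀ i, p i ∈ Set.Icc (0 : ℝ) 1) (hw : 0 ≤ w) :
    ∀ T : IndexTree ι, 0 ≤ T.weight p w
  | .leaf i => leafWeight_nonneg _ (hw i)
  | .node l r => combine_nonneg (mass_mem hp l) (mass_mem hp r) (weight_nonneg hp hw l)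
      (weight_nonneg hp hw r)

variable [DecidableEq ι]

/-- Forcing an index to be selected favours the event that the index at the root is selected. -/
lemma weight_cross {p w : ι → ℝ} (hp : ∀ i, p i ∈ Set.Icc (0 : ℝ) 1) (hw : 0 ≤ w) (i : ι) :
    ∀ T : IndexTree ι, T.leaves.Nodup →
      (T.weight p (Function.update w i 0)).2 * (T.weight p w).1 ≤
        (T.weight p (Function.update w i 0)).1 * (T.weight p w).2
  | .leaf k, _ => by
    rcases eq_or_ne k i with rfl | h
    · simpa [weight] using leafWeight_cross _ (hw k)
    · rw [weight_update_of_notMem _ _ (by simpa [leaves] using h.symm), mul_comm]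
  | .node l r, hT => by
    obtain ⟨hl, hr, hd⟩ := List.nodup_append'.1 hT
    by_cases hi : i ∈ l.leaves
    · have hir : i ∉ r.leaves := fun h => hd hi h
      simp only [weight, weight_update_of_notMem p w hir]
      exact combine_cross_left (mass_mem hp l) (mass_mem hp r) _ (weight_cross hp hw i l hl)
    · simp only [weight, weight_update_of_notMem p w hi]
      exact combine_cross_right (mass_mem hp l) (mass_mem hp r) _ (weight_cross hp hw i r hr)

lemma weight_neg_dep {p w : ι → ℝ} (hp : ∀ i, p i ∈ Set.Icc (0 : ℝ) 1) (hw : 0 ≤ w) {i j : ι}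
    (hij : i ≠ j) : ∀ T : IndexTree ι, T.leaves.Nodup → ∀ {a b : ℝ}, 0 ≤ a → 0 ≤ b →
      (a * (T.weight p (Function.update (Function.update w i 0) j 0)).1 +
          b * (T.weight p (Function.update (Function.update w i 0) j 0)).2) *
        (a * (T.weight p w).1 + b * (T.weight p w).2) ≤
      (a * (T.weight p (Function.update w i 0)).1 + b * (T.weight p (Function.update w i 0)).2) *
        (a * (T.weight p (Function.update w j 0)).1 + b * (T.weight p (Function.update w j 0)).2)
  | .leaf k, _, a, b, _, _ => by
    rcases eq_or_ne k i with rfl | h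
    · have hj : j ∉ (leaf k).leaves := by simpa [leaves] using hij.symm
      rw [weight_update_of_notMem _ _ hj, weight_update_of_notMem _ _ hj]
    · have hi : i ∉ (leaf k).leaves := by simpa [leaves] using h.symm
      rw [Function.update_comm hij, weight_update_of_notMem _ _ hi,
        weight_update_of_notMem _ _ hi, mul_comm]
  | .node l r, hT, a, b, ha, hb => by
    obtain ⟨hl, hr, hd⟩ := List.nodup_append'.1 hT
    obtain ⟨c₁₁, c₁₂, c₂₁, c₂₂, h₁₁, h₁₂, h₂₁, h₂₂, hc, H⟩ :=
      exists_combine_form (mass_mem hp l) (mass_mem hp r) ha hb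
    obtain ⟨hl1, hl2⟩ := Prod.le_def.1 (weight_nonneg hp hw l)
    obtain ⟨hr1, hr2⟩ := Prod.le_def.1 (weight_nonneg hp hw r)
    simp only [Prod.fst_zero, Prod.snd_zero] at hl1 hl2 hr1 hr2
    have hcross : ∀ {u u' v v' : ℝ × ℝ}, u'.2 * u.1 ≤ u'.1 * u.2 → v'.2 * v.1 ≤ v'.1 * v.2 →
        (c₁₁ * (u'.1 * v'.1) + c₁₂ * (u'.1 * v'.2) + c₂₁ * (u'.2 * v'.1) + c₂₂ * (u'.2 * v'.2)) *
          (c₁₁ * (u.1 * v.1) + c₁₂ * (u.1 * v.2) + c₂₁ * (u.2 * v.1) + c₂₂ * (u.2 * v.2)) ≤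
        (c₁₁ * (u'.1 * v.1) + c₁₂ * (u'.1 * v.2) + c₂₁ * (u'.2 * v.1) + c₂₂ * (u'.2 * v.2)) *
          (c₁₁ * (u.1 * v'.1) + c₁₂ * (u.1 * v'.2) + c₂₁ * (u.2 * v'.1) + c₂₂ * (u.2 * v'.2)) := by
      intro u u' v v' hu hv
      rw [← sub_nonneg] at hu hv hc ⊢
      exact (mul_nonneg hc (mul_nonneg hu hv)).trans_eq (by ring)
    simp only [weight, H]
    by_cases hi : i ∈ l.leaves
    · have hir : i ∉ r.leaves := fun h => hd hi h
      by_cases hj : j ∈ l.leaves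
      · have hjr : j ∉ r.leaves := fun h => hd hj h
        simp only [weight_update_of_notMem _ _ hir, weight_update_of_notMem _ _ hjr]
        have key := weight_neg_dep hp hw hij l hl
          (a := c₁₁ * (r.weight p w).1 + c₁₂ * (r.weight p w).2)
          (b := c₂₁ * (r.weight p w).1 + c₂₂ * (r.weight p w).2) (by positivity) (by positivity)
        convert key using 1 <;> ring
      · rw [weight_update_of_notMem _ _ hj, weight_update_of_notMem _ w hj,
          Function.update_comm hij, weight_update_of_notMem _ _ hir,
          weight_update_of_notMem _ w hir]
        exact hcross (weight_cross hp hw i l hl) (weight_cross hp hw j r hr)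
    · by_cases hj : j ∈ l.leaves
      · have hjr : j ∉ r.leaves := fun h => hd hj h
        rw [weight_update_of_notMem _ _ hjr, weight_update_of_notMem _ w hjr,
          Function.update_comm hij, weight_update_of_notMem _ _ hi, weight_update_of_notMem _ w hi,
          mul_comm (_ + _ : ℝ) (c₁₁ * ((l.weight p (Function.update w j 0)).1 * _) + _ + _ + _)]
        exact hcross (weight_cross hp hw j l hl) (weight_cross hp hw i r hr)
      · simp only [weight_update_of_notMem _ _ hi, weight_update_of_notMem _ _ hj]
        have key := weight_neg_dep hp hw hij r hr
          (a := c₁₁ * (l.weight p w).1 + c₂₁ * (l.weight p w).2)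
          (b := c₁₂ * (l.weight p w).1 + c₂₂ * (l.weight p w).2) (by positivity) (by positivity)
        convert key using 1 <;> ring

/-- The expected product of `w l` over the indices `l` of the tree that are not selected. -/
noncomputable def total (p w : ι → ℝ) (T : IndexTree ι) : ℝ :=
  if T.mass p = 1 then (T.weight p w).1 else (T.weight p w).2

lemma total_neg_dep {p w : ι → ℝ} (hp : ∀ i, p i ∈ Set.Icc (0 : ℝ) 1) (hw : 0 ≤ w) {i j : ι}
    (hij : i ≠ j) {T : IndexTree ι} (hT : T.leaves.Nodup) :
    T.total p (Function.update (Function.update w i 0) j 0) * T.total p w ≤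
      T.total p (Function.update w i 0) * T.total p (Function.update w j 0) := by
  unfold total
  split_ifs
  · simpa using weight_neg_dep hp hw hij T hT zero_le_one le_rfl
  · simpa using weight_neg_dep hp hw hij T hT le_rfl zero_le_one

end IndexTree

open IndexTree

section Step

variable {ι : Type} {T : IndexTree ι} {i j : ι} {C : ι → IndexTree ι}

lemma SiblingPair.exists_leaves (h : SiblingPair T i j C) :
    ∃ L : List ι, T.leaves.Perm (i :: j :: L) ∧ ∀ x, (C x).leaves.Perm (x :: L) := by
  induction h with
  | here i j => exact ⟨[], by simp [leaves], fun x => by simp [leaves]⟩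
  | swapped i j => exact ⟨[], by simpa [leaves] using List.Perm.swap i j [],
      fun x => by simp [leaves]⟩
  | @left l r i j C _ ih =>
    obtain ⟨L, h1, h2⟩ := ih
    exact ⟨L ++ r.leaves, h1.append_right _, fun x => (h2 x).append_right _⟩
  | @right l r i j C _ ih =>
    obtain ⟨L, h1, h2⟩ := ih
    exact ⟨l.leaves ++ L,
      (h1.append_left _).trans (List.perm_middle.trans (List.perm_middle.cons _)),
      fun x => ((h2 x).append_left _).trans List.perm_middle⟩

lemma SiblingPair.left_mem (h : SiblingPair T i j C) : i ∈ T.leaves := by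
  obtain ⟨L, hL, -⟩ := h.exists_leaves
  exact hL.mem_iff.2 (by simp)

lemma SiblingPair.right_mem (h : SiblingPair T i j C) : j ∈ T.leaves := by
  obtain ⟨L, hL, -⟩ := h.exists_leaves
  exact hL.mem_iff.2 (by simp)

/-- Replacing two sibling leaves by a leaf, where the weights of the pair are a linear combination
of the possible weights of the new leaf. -/
lemma SiblingPair.weight_eq (h : SiblingPair T i j C) (hT : T.leaves.Nodup) {p q q' w : ι → ℝ}
    {c d : ℝ}
    (hq : ∀ k, k ≠ i → k ≠ j → q k = p k) (hq' : ∀ k, k ≠ i → k ≠ j → q' k = p k)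
    (hqi : q i = residual (p i) (p j)) (hqj : q' j = residual (p i) (p j))
    (hw : combine (p i) (p j) (leafWeight (p i) (w i)) (leafWeight (p j) (w j)) =
      c • leafWeight (q i) (w i) + d • leafWeight (q' j) (w j))
    (hw' : combine (p j) (p i) (leafWeight (p j) (w j)) (leafWeight (p i) (w i)) =
      c • leafWeight (q i) (w i) + d • leafWeight (q' j) (w j)) :
    (C i).mass q = T.mass p ∧ (C j).mass q' = T.mass p ∧
      T.weight p w = c • (C i).weight q w + d • (C j).weight q' w := by
  induction h with
  | here i j => exact ⟨hqi, hqj, hw⟩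
  | swapped i j =>
    refine ⟨hqi.trans ?_, hqj.trans ?_, hw'⟩ <;> simp only [mass, residual, add_comm]
  | @left l r i j C h ih =>
    obtain ⟨hl, hr, hd⟩ := List.nodup_append'.1 hT
    obtain ⟨h1, h2, h3⟩ := ih hl hq hq' hqi hqj hw hw'
    have hi : ∀ k ∈ r.leaves, k ≠ i := fun k hk e => hd h.left_mem (e ▸ hk)
    have hj : ∀ k ∈ r.leaves, k ≠ j := fun k hk e => hd h.right_mem (e ▸ hk)
    have e1 : ∀ k ∈ r.leaves, q k = p k := fun k hk => hq k (hi k hk) (hj k hk)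
    have e2 : ∀ k ∈ r.leaves, q' k = p k := fun k hk => hq' k (hi k hk) (hj k hk)
    simp only [mass, weight, h1, h2, h3, mass_congr e1, mass_congr e2, combine_add_left,
      weight_congr e1 fun k _ => rfl, weight_congr e2 fun k _ => rfl, and_self]
  | @right l r i j C h ih =>
    obtain ⟨hl, hr, hd⟩ := List.nodup_append'.1 hT
    obtain ⟨h1, h2, h3⟩ := ih hr hq hq' hqi hqj hw hw'
    have hi : ∀ k ∈ l.leaves, k ≠ i := fun k hk e => hd hk (e ▸ h.left_mem)
    have hj : ∀ k ∈ l.leaves, k ≠ j := fun k hk e => hd hk (e ▸ h.right_mem)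
    have e1 : ∀ k ∈ l.leaves, q k = p k := fun k hk => hq k (hi k hk) (hj k hk)
    have e2 : ∀ k ∈ l.leaves, q' k = p k := fun k hk => hq' k (hi k hk) (hj k hk)
    simp only [mass, weight, h1, h2, h3, mass_congr e1, mass_congr e2, combine_add_right,
      weight_congr e1 fun k _ => rfl, weight_congr e2 fun k _ => rfl, and_self]

lemma SiblingPair.total_eq (h : SiblingPair T i j C) (hT : T.leaves.Nodup) {p q q' w : ι → ℝ}
    {c d : ℝ}
    (hq : ∀ k, k ≠ i → k ≠ j → q k = p k) (hq' : ∀ k, k ≠ i → k ≠ j → q' k = p k)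
    (hqi : q i = residual (p i) (p j)) (hqj : q' j = residual (p i) (p j))
    (hw : combine (p i) (p j) (leafWeight (p i) (w i)) (leafWeight (p j) (w j)) =
      c • leafWeight (q i) (w i) + d • leafWeight (q' j) (w j))
    (hw' : combine (p j) (p i) (leafWeight (p j) (w j)) (leafWeight (p i) (w i)) =
      c • leafWeight (q i) (w i) + d • leafWeight (q' j) (w j)) :
    T.total p w = c * (C i).total q w + d * (C j).total q' w := by
  obtain ⟨h1, h2, h3⟩ := h.weight_eq hT hq hq' hqi hqj hw hw'
  unfold total
  rw [h1, h2, h3]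
  split_ifs <;> simp

end Step

section Law

variable {ι : Type} [DecidableEq ι]

instance isFiniteMeasure_mix {Ω : Type} [MeasurableSpace Ω] (q : ℝ) (μ ν : Measure Ω)
    [IsFiniteMeasure μ] [IsFiniteMeasure ν] : IsFiniteMeasure (mix q μ ν) := by
  refine ⟨?_⟩
  simp only [mix, Measure.add_apply, Measure.smul_apply, smul_eq_mul]
  exact ENNReal.add_lt_top.2 ⟨ENNReal.mul_lt_top ENNReal.ofReal_lt_top (measure_lt_top _ _),
    ENNReal.mul_lt_top ENNReal.ofReal_lt_top (measure_lt_top _ _)⟩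

lemma mix_real {Ω : Type} [MeasurableSpace Ω] {q : ℝ} (hq : q ∈ Set.Icc (0 : ℝ) 1)
    (μ ν : Measure Ω) [IsFiniteMeasure μ] [IsFiniteMeasure ν] (s : Set Ω) :
    (mix q μ ν).real s = q * μ.real s + (1 - q) * ν.real s := by
  simp only [mix, Measure.real, Measure.add_apply, Measure.smul_apply, smul_eq_mul]
  rw [ENNReal.toReal_add (ENNReal.mul_ne_top ENNReal.ofReal_ne_top (measure_ne_top _ _))
    (ENNReal.mul_ne_top ENNReal.ofReal_ne_top (measure_ne_top _ _)), ENNReal.toReal_mul,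
    ENNReal.toReal_mul, ENNReal.toReal_ofReal hq.1, ENNReal.toReal_ofReal (sub_nonneg.2 hq.2)]

lemma RunLaw.isFiniteMeasure {T : IndexTree ι} {p : ι → ℝ} {A : Finset ι}
    {μ : Measure (ι → Bool)} (h : RunLaw T p A μ) : IsFiniteMeasure μ := by
  induction h with
  | done => infer_instance
  | low _ _ _ _ ihi ihj => infer_instance
  | high _ _ _ _ ihi ihj => infer_instance

/-- The weight that is `0` on `S` and `1` elsewhere. -/
def avoid (S : Finset ι) (l : ι) : ℝ := if l ∈ S then 0 else 1

lemma avoid_insert (S : Finset ι) (i : ι) :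
    avoid (insert i S) = Function.update (avoid S) i 0 := by
  ext l
  by_cases h : l = i <;> simp [avoid, h]

variable [Fintype ι]

lemma RunLaw.real_eq {T : IndexTree ι} {p : ι → ℝ} {A : Finset ι} {μ : Measure (ι → Bool)}
    (h : RunLaw T p A μ) (hT : T.leaves.Nodup) (hA : ∀ l ∈ T.leaves, l ∉ A)
    (hp : ∀ l, p l ∈ Set.Icc (0 : ℝ) 1) (S : Finset ι) :
    μ.real {ξ | ∀ l ∈ S, ξ l = true} =
      (∏ l with l ∉ T.leaves ∧ l ∉ A, avoid S l) * T.total p (avoid S) := by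
  induction h with
  | done r p A =>
    have hprod : (∏ l with l ∉ (leaf r).leaves ∧ l ∉ A, avoid S l) =
        if ∀ l ∈ S, l = r ∨ l ∈ A then 1 else 0 := by
      split_ifs with h
      · refine Finset.prod_eq_one fun l hl => if_neg fun hS => ?_
        simp only [leaves, List.mem_singleton, Finset.mem_filter] at hl
        exact (h l hS).elim hl.2.1 hl.2.2
      · push Not at h
        obtain ⟨l, hl, h1, h2⟩ := h
        exact Finset.prod_eq_zero (i := l) (by simp [leaves, h1, h2]) (if_pos hl)
    have hr : r ∉ A := hA r (by simp [leaves])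
    rw [hprod, Measure.real, Measure.dirac_apply' _ (Set.toFinite _).measurableSet]
    by_cases h1 : p r = 1
    · simp only [total, mass, weight, leafWeight, h1, if_true]
      by_cases hS : ∀ l ∈ S, l = r ∨ l ∈ A
      · simp [Set.indicator, if_pos hS]
      · simp [Set.indicator, hS]
    · simp only [total, mass, weight, leafWeight, h1, if_false, avoid]
      by_cases hS : ∀ l ∈ S, l = r ∨ l ∈ A
      · by_cases hrS : r ∈ S
        · have : ¬ ∀ l ∈ S, l ∈ A := fun h => hr (h r hrS)
          simp [Set.indicator, hrS, this]
        · have : ∀ l ∈ S, l ∈ A := fun l hl => (hS l hl).resolve_left fun e => hrS (e ▸ hl)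
          simp [Set.indicator, hrS, if_pos hS, if_pos this]
      · have : ¬ ∀ l ∈ S, l ∈ A := fun h => hS fun l hl => .inr (h l hl)
        simp [Set.indicator, hS, this]
  | @low T i j C p A μ ν hC hs hi hj ihi ihj =>
    have := hi.isFiniteMeasure
    have := hj.isFiniteMeasure
    obtain ⟨L, hL, hCL⟩ := hC.exists_leaves
    have hnd := hL.nodup_iff.1 hT
    simp only [List.nodup_cons, List.mem_cons, not_or] at hnd
    obtain ⟨⟨hij, hiL⟩, hjL, hLn⟩ := hnd
    have hmem : ∀ l, l ∈ T.leaves ↔ l = i ∨ l = j ∨ l ∈ L := fun l => by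
      simpa using hL.mem_iff (a := l)
    have hCmem : ∀ x l, l ∈ (C x).leaves ↔ l = x ∨ l ∈ L := fun x l => by
      simpa using (hCL x).mem_iff (a := l)
    have hsum : p i + p j ∈ Set.Icc (0 : ℝ) 1 := ⟨add_nonneg (hp i).1 (hp j).1, hs⟩
    rw [mix_real (low_prob_mem (hp i) (hp j)),
      ihi ((hCL i).nodup_iff.2 (List.nodup_cons.2 ⟨hiL, hLn⟩))
        (fun l hl => hA l ((hmem l).2 (((hCmem i l).1 hl).imp_right .inr)))
        (fun l => by
          rcases eq_or_ne l j with rfl | h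
          · simp
          · rcases eq_or_ne l i with rfl | h' <;> simp [*, -Set.mem_Icc]),
      ihj ((hCL j).nodup_iff.2 (List.nodup_cons.2 ⟨hjL, hLn⟩))
        (fun l hl => hA l ((hmem l).2 (.inr ((hCmem j l).1 hl))))
        (fun l => by
          rcases eq_or_ne l i with rfl | h
          · simp
          · rcases eq_or_ne l j with rfl | h' <;> simp [*, -Set.mem_Icc])]
    have hlow := combine_leafWeight_low (hp i).1 (hp j).1 hs (avoid S i) (avoid S j)
    rw [hC.total_eq hT (p := p) (w := avoid S)
      (q := Function.update (Function.update p i (p i + p j)) j 0)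
      (q' := Function.update (Function.update p j (p i + p j)) i 0)
      (c := p i / (p i + p j) * avoid S j) (d := (1 - p i / (p i + p j)) * avoid S i)
      (fun k h1 h2 => by simp [h1, h2]) (fun k h1 h2 => by simp [h1, h2])
      (by simp [hij, residual, hs]) (by simp [Ne.symm hij, residual, hs])
      (by simpa [hij, Ne.symm hij] using hlow)
      (by rw [combine_leafWeight_comm (hp i) (hp j)]; simpa [hij, Ne.symm hij] using hlow)]
    have hfi : (∏ l with l ∉ (C i).leaves ∧ l ∉ A, avoid S l) =
        avoid S j * ∏ l with l ∉ T.leaves ∧ l ∉ A, avoid S l := by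
      rw [← Finset.prod_insert (by simp [hmem])]
      refine Finset.prod_congr (Finset.ext fun l => ?_) fun _ _ => rfl
      have := hA j ((hmem j).2 (by simp))
      rcases eq_or_ne l j with rfl | h
      · simp [hCmem, hjL, Ne.symm hij, this]
      · simp [hCmem, hmem, h]
    have hfj : (∏ l with l ∉ (C j).leaves ∧ l ∉ A, avoid S l) =
        avoid S i * ∏ l with l ∉ T.leaves ∧ l ∉ A, avoid S l := by
      rw [← Finset.prod_insert (by simp [hmem])]
      refine Finset.prod_congr (Finset.ext fun l => ?_) fun _ _ => rfl
      have := hA i ((hmem i).2 (by simp))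
      rcases eq_or_ne l i with rfl | h
      · simp [hCmem, hiL, hij, this]
      · simp [hCmem, hmem, h]
    rw [hfi, hfj]
    ring
  | @high T i j C p A μ ν hC hs hi hj ihi ihj =>
    have := hi.isFiniteMeasure
    have := hj.isFiniteMeasure
    obtain ⟨L, hL, hCL⟩ := hC.exists_leaves
    have hnd := hL.nodup_iff.1 hT
    simp only [List.nodup_cons, List.mem_cons, not_or] at hnd
    obtain ⟨⟨hij, hiL⟩, hjL, hLn⟩ := hnd
    have hmem : ∀ l, l ∈ T.leaves ↔ l = i ∨ l = j ∨ l ∈ L := fun l => by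
      simpa using hL.mem_iff (a := l)
    have hCmem : ∀ x l, l ∈ (C x).leaves ↔ l = x ∨ l ∈ L := fun x l => by
      simpa using (hCL x).mem_iff (a := l)
    have hsum : p i + p j - 1 ∈ Set.Icc (0 : ℝ) 1 :=
      ⟨by linarith, by linarith [(hp i).2, (hp j).2]⟩
    rw [mix_real (high_prob_mem (hp i) (hp j)),
      ihi ((hCL i).nodup_iff.2 (List.nodup_cons.2 ⟨hiL, hLn⟩))
        (fun l hl => by
          have h1 := (hCmem i l).1 hl
          have h2 := hA l ((hmem l).2 (h1.imp_right .inr))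
          have h3 : l ≠ j := by
            rintro rfl
            exact h1.elim (Ne.symm hij) hjL
          simp [h2, h3])
        (fun l => by
          rcases eq_or_ne l j with rfl | h
          · simp
          · rcases eq_or_ne l i with rfl | h' <;> simp [*, -Set.mem_Icc]),
      ihj ((hCL j).nodup_iff.2 (List.nodup_cons.2 ⟨hjL, hLn⟩))
        (fun l hl => by
          have h1 := (hCmem j l).1 hl
          have h2 := hA l ((hmem l).2 (.inr h1))
          have h3 : l ≠ i := by
            rintro rfl
            exact h1.elim hij hiL
          simp [h2, h3])
        (fun l => by
          rcases eq_or_ne l i with rfl | h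
          · simp
          · rcases eq_or_ne l j with rfl | h' <;> simp [*, -Set.mem_Icc])]
    have hhigh := combine_leafWeight_high (hp i).2 (hp j).2 hs (avoid S i) (avoid S j)
    rw [hC.total_eq hT (p := p) (w := avoid S)
      (q := Function.update (Function.update p i (p i + p j - 1)) j 1)
      (q' := Function.update (Function.update p j (p i + p j - 1)) i 1)
      (c := (1 - p i) / (2 - p i - p j)) (d := 1 - (1 - p i) / (2 - p i - p j))
      (fun k h1 h2 => by simp [h1, h2]) (fun k h1 h2 => by simp [h1, h2])
      (by simp [hij, residual, hs]) (by simp [Ne.symm hij, residual, hs])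
      (by simpa [hij, Ne.symm hij] using hhigh)
      (by rw [combine_leafWeight_comm (hp i) (hp j)]; simpa [hij, Ne.symm hij] using hhigh)]
    have hfi : (∏ l with l ∉ (C i).leaves ∧ l ∉ insert j A, avoid S l) =
        ∏ l with l ∉ T.leaves ∧ l ∉ A, avoid S l :=
      Finset.prod_congr (Finset.ext fun l => by simp [hCmem, hmem]; tauto) fun _ _ => rfl
    have hfj : (∏ l with l ∉ (C j).leaves ∧ l ∉ insert i A, avoid S l) =
        ∏ l with l ∉ T.leaves ∧ l ∉ A, avoid S l :=
      Finset.prod_congr (Finset.ext fun l => by simp [hCmem, hmem]; tauto) fun _ _ => rfl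
    rw [hfi, hfj]
    ring

lemma IsPivotalLaw.real_eq {T : IndexTree ι} {p : ι → ℝ} {μ : Measure (ι → Bool)}
    (h : IsPivotalLaw T p μ) (hT : ∀ i, T.leaves.count i = 1)
    (hp : ∀ l, p l ∈ Set.Icc (0 : ℝ) 1) (S : Finset ι) :
    μ.real {ξ | ∀ l ∈ S, ξ l = true} = T.total p (avoid S) := by
  have hmem : ∀ l, l ∈ T.leaves := fun l => List.count_pos_iff.1 (by simp [hT])
  rw [RunLaw.real_eq h (List.nodup_iff_count_le_one.2 fun i => (hT i).le) (by simp) hp]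
  simp [hmem]

lemma IsPivotalLaw.neg_dep {T : IndexTree ι} {p : ι → ℝ} {μ : Measure (ι → Bool)}
    (h : IsPivotalLaw T p μ) (hT : ∀ i, T.leaves.count i = 1)
    (hp : ∀ l, p l ∈ Set.Icc (0 : ℝ) 1) (S : Finset ι) {i j : ι} (hij : i ≠ j) :
    μ {ξ | ∀ l ∈ insert j (insert i S), ξ l = true} * μ {ξ | ∀ l ∈ S, ξ l = true} ≤
      μ {ξ | ∀ l ∈ insert i S, ξ l = true} * μ {ξ | ∀ l ∈ insert j S, ξ l = true} := by
  have := RunLaw.isFiniteMeasure h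
  have key := total_neg_dep (w := avoid S) hp
    (fun l => by unfold avoid; dsimp only [Pi.zero_apply]; split_ifs <;> norm_num) hij
    (List.nodup_iff_count_le_one.2 fun i => (hT i).le)
  rw [← avoid_insert, ← avoid_insert, ← avoid_insert, ← h.real_eq hT hp, ← h.real_eq hT hp,
    ← h.real_eq hT hp, ← h.real_eq hT hp] at key
  simp only [Measure.real, ← ENNReal.toReal_mul] at key
  exact (ENNReal.toReal_le_toReal (ENNReal.mul_ne_top (measure_ne_top _ _) (measure_ne_top _ _))
    (ENNReal.mul_ne_top (measure_ne_top _ _) (measure_ne_top _ _))).1 key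

end Law

end PivotalSampling

theorem mainTheorem4 {n k : ℕ} (T : PivotalSampling.IndexTree (Fin n))
    (hT : ∀ i, T.leaves.count i = 1)
    (p : Fin n → ℝ) (hp : ∀ i, p i ∈ Set.Icc (0 : ℝ) 1) (hk : ∑ i, p i = (k : ℝ))
    (μ : Measure (Fin n → Bool)) (hμ : PivotalSampling.IsPivotalLaw T p μ)
    (S : Finset (Fin n)) (hS : 0 < μ {ξ | ∀ l ∈ S, ξ l = true})
    (i j : Fin n) (hi : i ∉ S) (hj : j ∉ S) (hij : i ≠ j) :
    μ[{ξ | ξ i = true ∧ ξ j = true} | {ξ | ∀ l ∈ S, ξ l = true}] ≤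
      μ[{ξ | ξ i = true} | {ξ | ∀ l ∈ S, ξ l = true}] *
        μ[{ξ | ξ j = true} | {ξ | ∀ l ∈ S, ξ l = true}] := by
  have := PivotalSampling.RunLaw.isFiniteMeasure hμ
  have key := hμ.neg_dep hT hp S hij
  have hs : MeasurableSet {ξ : Fin n → Bool | ∀ l ∈ S, ξ l = true} := (Set.toFinite _).measurableSet
  have eij : {ξ : Fin n → Bool | ∀ l ∈ S, ξ l = true} ∩ {ξ | ξ i = true ∧ ξ j = true} =
      {ξ | ∀ l ∈ insert j (insert i S), ξ l = true} := by
    ext ξ; simp; tauto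
  have ei : ∀ i : Fin n, {ξ : Fin n → Bool | ∀ l ∈ S, ξ l = true} ∩ {ξ | ξ i = true} =
      {ξ | ∀ l ∈ insert i S, ξ l = true} := by
    intro i; ext ξ; simp; tauto
  rw [cond_apply hs, cond_apply hs, cond_apply hs, eij, ei, ei]
  set m := μ {ξ | ∀ l ∈ S, ξ l = true} with hm
  have hm1 : m⁻¹ * m = 1 := ENNReal.inv_mul_cancel hS.ne' (measure_ne_top _ _)
  calc m⁻¹ * μ {ξ | ∀ l ∈ insert j (insert i S), ξ l = true}
      = m⁻¹ * (m⁻¹ * m) * μ {ξ | ∀ l ∈ insert j (insert i S), ξ l = true} := by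
        rw [hm1, mul_one]
    _ = m⁻¹ * m⁻¹ * (μ {ξ | ∀ l ∈ insert j (insert i S), ξ l = true} * m) := by ring
    _ ≤ m⁻¹ * m⁻¹ * (μ {ξ | ∀ l ∈ insert i S, ξ l = true} *
          μ {ξ | ∀ l ∈ insert j S, ξ l = true}) := mul_le_mul_right key _
    _ = _ := by ring
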